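/- **Corollary (Generalization bound for EKL).** Let $\mathcal X$ be a measurable space, let $m,p,r\ge 0$ and $n\ge 1$ be integers, let $\phi:\mathcal X\to\mathbb R^m$ be a measurable feature map with kernel $k(\mathbf x,\mathbf z)=\langle\phi(\mathbf x),\phi(\mathbf z)\rangle$, and suppose $k(\mathbf x,\mathbf x)\le\kappa$ for all $\mathbf x\in\mathcal X$. For $\mathbf Q\in\mathbb R^{mp\times r}$ let $$K_{\mathbf Q}(\mathbf x,\mathbf z)=(\phi(\mathbf x)^\top\otimes \mathbf I_p)\,\mathbf Q\mathbf Q^\top(\phi(\mathbf z)\otimes \mathbf I_p)\in\mathbb R^{p\times p},$$ let $\mathcal H_{\mathbf Q}$ be the vector-valued reproducing kernel Hilbert space of $K_{\mathbf Q}$, and let $\Gamma_{\mathbf Q}(\mathbf x):\mathbb R^p\to\mathcal H_{\mathbf Q}$, $\Gamma_{\mathbf Q}(\mathbf x)\mathbf y=K_{\mathbf Q}(\cdot,\mathbf x)\mathbf y$, be its feature map. For $\beta\in\mathbb R$ put $$\mathcal H_\beta=\{\mathbf x\mapsto\Gamma_{\mathbf Q}(\mathbf x)^*u \;:\; \mathbf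 Q\in\mathbb R^{mp\times r},\ \|\mathbf Q\|_F=1,\ u\in\mathcal H_{\mathbf Q},\ \|u\|_{\mathcal H_{\mathbf Q}}\le\beta\}.$$ Let $P$ be a probability distribution on $\mathcal X\times\mathbb R^p$, let $M>0$, and assume that for every $f\in\mathcal H_\beta$ one has $\|f(\mathbf x)-\mathbf y\|\le M$ for $P$-almost every $(\mathbf x,\mathbf y)$. Then for every $\delta>0$, with probability at least $1-\delta$ over an i.i.d. sample $(\mathbf x_1,\mathbf y_1),\dots,(\mathbf x_n,\mathbf y_n)$ from $P$, every $f\in\mathcal H_\beta$ satisfies $$R(f)\le \hat R(f)+4\sqrt2\,M\sqrt{\frac{\beta^2\kappa p}{n}}+3M^2\sqrt{\frac{\log(2/\delta)}{2n}}$$ (for $\delta\ge 1$ the assertion is trivial), where $R(f)=\mathbb E_{(\mathbf x,\mathbf y)\sim P}\|f(\mathbf x)-\mathbf y\|^2$ and $\hat R(f)=\frac1n\sum_{i=1}^n\|f(\mathbf x_i)-\mathbf y_i\|^2$. -/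

import Mathlib

open MeasureTheory
open scoped Matrix Kronecker ComplexOrder

namespace EKL

variable {X : Type*} {m p r n : ℕ}

/-- The scalar-valued kernel `k(x, z) = ⟨φ(x), φ(z)⟩` of a feature map `φ : X → ℝ^m`. -/
noncomputable def scalarKernel (φ : X → EuclideanSpace ℝ (Fin m)) (x z : X) : ℝ :=
  inner ℝ (φ x) (φ z)

/-- The `mp × p` matrix `φ(x) ⊗ I_p`, with `φ(x)` read as an `m × 1` matrix. -/
def featureBlock (φ : X → EuclideanSpace ℝ (Fin m)) (p : ℕ) (x : X) :
    Matrix (Fin m × Fin p) (Fin p) ℝ :=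
  (Matrix.replicateCol Unit (φ x) ⊗ₖ (1 : Matrix (Fin p) (Fin p) ℝ)).submatrix id (Prod.mk ())

/-- The `p × p` matrix `K_Q(x, z) = (φ(x)ᵀ ⊗ I_p) D (φ(z) ⊗ I_p)` with `D = Q Qᵀ`. -/
def kernelMatrix (φ : X → EuclideanSpace ℝ (Fin m)) (Q : Matrix (Fin m × Fin p) (Fin r) ℝ)
    (x z : X) : Matrix (Fin p) (Fin p) ℝ :=
  (featureBlock φ p x)ᵀ * (Q * Qᵀ) * featureBlock φ p z

/-- The learnable entangled kernel `K_Q`, as an `L(ℝ^p)`-valued kernel on `X`. -/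
noncomputable def entangledKernel (φ : X → EuclideanSpace ℝ (Fin m))
    (Q : Matrix (Fin m × Fin p) (Fin r) ℝ) :
    Matrix X X (EuclideanSpace ℝ (Fin p) →L[ℝ] EuclideanSpace ℝ (Fin p)) :=
  Matrix.of fun x z => Matrix.toEuclideanCLM (n := Fin p) (𝕜 := ℝ) (kernelMatrix φ Q x z)

/-- The block kernel matrix over a sample is `(Φᵀ ⊗ I_p) D (Φ ⊗ I_p)` with
`Φ = [φ(x₁), …, φ(xₙ)]`. -/
theorem gram_eq (φ : X → EuclideanSpace ℝ (Fin m)) (Q : Matrix (Fin m × Fin p) (Fin r) ℝ)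
    (x : Fin n → X) :
    (Matrix.of fun is jt : Fin n × Fin p => kernelMatrix φ Q (x is.1) (x jt.1) is.2 jt.2) =
      ((Matrix.of fun (a : Fin m) (i : Fin n) => φ (x i) a)ᵀ ⊗ₖ
          (1 : Matrix (Fin p) (Fin p) ℝ)) * (Q * Qᵀ) *
        ((Matrix.of fun (a : Fin m) (i : Fin n) => φ (x i) a) ⊗ₖ
          (1 : Matrix (Fin p) (Fin p) ℝ)) := by
  ext ⟨i, s⟩ ⟨j, t⟩
  simp [kernelMatrix, featureBlock, Matrix.mul_apply, Matrix.one_apply, eq_comm]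

theorem inner_entangledKernel (φ : X → EuclideanSpace ℝ (Fin m))
    (Q : Matrix (Fin m × Fin p) (Fin r) ℝ) (x z : X) (v w : EuclideanSpace ℝ (Fin p)) :
    inner ℝ (entangledKernel φ Q x z v) w =
      inner ℝ (Matrix.toEuclideanLin (Qᵀ * featureBlock φ p z) v)
        (Matrix.toEuclideanLin (Qᵀ * featureBlock φ p x) w) := by
  have h : kernelMatrix φ Q x z =
      (Qᵀ * featureBlock φ p x)ᵀ * (Qᵀ * featureBlock φ p z) := by
    simp [kernelMatrix, Matrix.mul_assoc]
  simp only [EuclideanSpace.inner_eq_star_dotProduct, entangledKernel, Matrix.of_apply,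
    Matrix.ofLp_toEuclideanCLM, Matrix.ofLp_toLpLin, Matrix.toEuclideanLin, Matrix.toLin'_apply,
    star_trivial]
  rw [h, ← Matrix.mulVec_mulVec, Matrix.dotProduct_mulVec, Matrix.vecMul_transpose]

/-- The entangled kernel is positive semi-definite. -/
theorem posSemidef_entangledKernel (φ : X → EuclideanSpace ℝ (Fin m))
    (Q : Matrix (Fin m × Fin p) (Fin r) ℝ) : (entangledKernel φ Q).PosSemidef := by
  have hsymm : ∀ x z v w, inner ℝ (entangledKernel φ Q x z v) w =
      inner ℝ v (entangledKernel φ Q z x w) := by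
    intro x z v w
    exact (inner_entangledKernel φ Q x z v w).trans ((real_inner_comm _ _).trans
      ((inner_entangledKernel φ Q z x w v).symm.trans (real_inner_comm _ _)))
  have key := (RKHS.posSemidef_tfae (K := entangledKernel φ Q)).out 0 2
  refine key.2 ?_
  refine ⟨?_, fun vv => ?_⟩
  · ext1 x z
    refine ContinuousLinearMap.ext fun v => ext_inner_right ℝ fun w => ?_
    rw [Matrix.conjTranspose_apply, ContinuousLinearMap.star_eq_adjoint,
      ContinuousLinearMap.adjoint_inner_left, hsymm]
  · simp only [inner_entangledKernel]
    simp only [Finsupp.sum, ← inner_sum, ← sum_inner]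
    exact inner_self_nonneg (𝕜 := ℝ) (E := EuclideanSpace ℝ (Fin r))

instance (φ : X → EuclideanSpace ℝ (Fin m)) (Q : Matrix (Fin m × Fin p) (Fin r) ℝ) :
    Fact (entangledKernel φ Q).PosSemidef :=
  ⟨posSemidef_entangledKernel φ Q⟩

/-- The vector-valued reproducing kernel Hilbert space of `K_Q`. -/
abbrev rkhs (φ : X → EuclideanSpace ℝ (Fin m)) (Q : Matrix (Fin m × Fin p) (Fin r) ℝ) :=
  RKHS.OfKernel (entangledKernel φ Q)

/-- The feature map `Γ_Q : X → L(ℝ^p, ℋ)` of `K_Q`, `Γ_Q(z) y = K_Q(·, z) y`. -/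
noncomputable def featureMap (φ : X → EuclideanSpace ℝ (Fin m))
    (Q : Matrix (Fin m × Fin p) (Fin r) ℝ) (x : X) :
    EuclideanSpace ℝ (Fin p) →L[ℝ] rkhs φ Q :=
  RKHS.kerFun (rkhs φ Q) x

/-- `K_Q(x, z) = Γ_Q(x)^* Γ_Q(z)`. -/
theorem entangledKernel_eq (φ : X → EuclideanSpace ℝ (Fin m))
    (Q : Matrix (Fin m × Fin p) (Fin r) ℝ) (x z : X) :
    entangledKernel φ Q x z =
      (ContinuousLinearMap.adjoint (featureMap φ Q x)).comp (featureMap φ Q z) := by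
  rw [featureMap, featureMap, ← RKHS.kernel_apply, RKHS.OfKernel.kernel_ofKernel]

/-- The Frobenius norm. -/
noncomputable def frobeniusNorm (Q : Matrix (Fin m × Fin p) (Fin r) ℝ) : ℝ :=
  √(∑ i, ∑ j, Q i j ^ 2)

/-- The hypothesis class
`H_β = {x ↦ Γ_Q(x)^* u : Q ∈ ℝ^{mp × r}, ‖Q‖_F = 1, u ∈ ℋ, ‖u‖ ≤ β}`. -/
def hypothesisClass (φ : X → EuclideanSpace ℝ (Fin m)) (p r : ℕ) (β : ℝ) :
    Set (X → EuclideanSpace ℝ (Fin p)) :=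
  {f | ∃ Q : Matrix (Fin m × Fin p) (Fin r) ℝ, frobeniusNorm Q = 1 ∧
    ∃ u : rkhs φ Q, ‖u‖ ≤ β ∧
      f = fun x => ContinuousLinearMap.adjoint (featureMap φ Q x) u}

/-- The expected risk `R(f) = 𝔼 ‖f(x) - y‖²` for `(x, y)` with distribution `P`. -/
noncomputable def risk [MeasurableSpace X] (P : Measure (X × EuclideanSpace ℝ (Fin p)))
    (f : X → EuclideanSpace ℝ (Fin p)) : ℝ :=
  ∫ z, ‖f z.1 - z.2‖ ^ 2 ∂P

/-- The empirical risk `R̂(f) = (1/n) ∑ᵢ ‖f(xᵢ) - yᵢ‖²` on the sample `S`. -/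
noncomputable def empiricalRisk (S : Fin n → X × EuclideanSpace ℝ (Fin p))
    (f : X → EuclideanSpace ℝ (Fin p)) : ℝ :=
  (1 / (n : ℝ)) * ∑ i, ‖f (S i).1 - (S i).2‖ ^ 2

end EKL

/-! The class sits inside a ball of linear predictors. Every element of the reproducing kernel
Hilbert space of `K_Q` is `x ↦ (φ(x)ᵀ ⊗ I_p) Q v` with `‖v‖ ≤ ‖u‖`, so with `‖Q‖_F = 1` each
hypothesis is `contract W (φ x)` with `‖W‖ ≤ β` (`exists_eq_contract`). Its square loss is affine in
the statistics `(φ ⊗ φ, φ ⊗ y, ‖y‖²)`, with coefficients of norm at most `β²` and `2β`. By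
Cauchy–Schwarz, `R(f) - R̂(f)` is therefore bounded for all `f` at once by one random variable, the
`gap` between true and empirical means of the statistics (`risk_le_empiricalRisk_add_gap`). No
symmetrization is needed.

The residual bound, tested on rank-one hypotheses and made uniform by separability, gives `β‖φ(x)‖ +
‖y‖ ≤ M` almost surely (`ae_mul_norm_add_norm_le`). Hence one sample moves the gap by at most `(β‖φ‖
+ ‖y‖)²/n ≤ M²/n`, and a bounded-difference argument makes the centred gap sub-Gaussian
(`hasSubgaussianMGF_comp_sum`). A variance computation bounds the mean gap by `3βM√κ/√n`
(`integral_gap_le`). Both estimates are sharper than the stated terms. -/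

namespace EKL
open ProbabilityTheory
open scoped NNReal
variable {X : Type*} {m p r n : ℕ}

/-! ### Bounded differences for functions of an i.i.d. sum. -/

section Concentration

/-- A function changing by at most `C` under translation by `T z` changes by at most `n C` under
translation by the sum of `T` over a sample of size `n`. -/
theorem ae_abs_comp_add_sum_sub_le {Z E : Type*} [MeasurableSpace Z] {P : Measure Z}
    [IsProbabilityMeasure P] [AddCommGroup E] {T : Z → E} {g : E → ℝ} {C : ℝ}
    (hC : ∀ᵐ z ∂P, ∀ x, |g (x + T z) - g x| ≤ C) (n : ℕ) :
    ∀ᵐ S ∂Measure.pi (fun _ : Fin n => P), ∀ x, |g (x + ∑ i, T (S i)) - g x| ≤ n * C := by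
  have h : ∀ᵐ S ∂Measure.pi (fun _ : Fin n => P), ∀ i, ∀ x, |g (x + T (S i)) - g x| ≤ C :=
    ae_all_iff.2 fun i => (measurePreserving_eval (fun _ : Fin n => P) i).quasiMeasurePreserving.ae
      hC
  filter_upwards [h] with S hS x
  have key : ∀ s : Finset (Fin n), |g (x + ∑ i ∈ s, T (S i)) - g x| ≤ s.card * C := by
    intro s
    induction s using Finset.induction_on with
    | empty => simp
    | insert a s ha ih =>
      rw [Finset.sum_insert ha, Finset.card_insert_of_notMem ha, add_comm (T (S a)), ← add_assoc]
      have h1 := hS a (x + ∑ i ∈ s, T (S i))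
      rw [abs_le] at *
      push_cast
      constructor <;> linarith
  simpa using key Finset.univ

variable {Z E : Type*} [MeasurableSpace Z] {P : Measure Z} [IsProbabilityMeasure P]
  [AddCommGroup E] [MeasurableSpace E] [MeasurableAdd₂ E]

/-- The centred value of a function of a sum of independent random elements is sub-Gaussian if each
summand changes the function by a bounded amount. -/
theorem hasSubgaussianMGF_comp_sum {T : Z → E} (hT : Measurable T) {g : E → ℝ} (hg : Measurable g)
    {C : ℝ≥0} (hC : ∀ᵐ z ∂P, ∀ x, |g (x + T z) - g x| ≤ C) (n : ℕ) (x : E) :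
    HasSubgaussianMGF
      (fun S : Fin n → Z => g (x + ∑ i, T (S i)) -
        ∫ S', g (x + ∑ i, T (S' i)) ∂Measure.pi (fun _ : Fin n => P))
      (n * C ^ 2) (Measure.pi (fun _ : Fin n => P)) := by
  have hmeas : ∀ (n : ℕ) (x : E), Measurable fun S : Fin n → Z => g (x + ∑ i, T (S i)) := by
    intro n x
    fun_prop
  have hIcc : ∀ (n : ℕ) (x : E), ∀ᵐ S ∂Measure.pi (fun _ : Fin n => P),
      g (x + ∑ i, T (S i)) ∈ Set.Icc (g x - n * C) (g x + n * C) := by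
    intro n x
    filter_upwards [ae_abs_comp_add_sum_sub_le hC n] with S hS
    have := abs_le.1 (hS x)
    constructor <;> linarith
  have hint : ∀ (n : ℕ) (x : E), Integrable (fun S : Fin n → Z => g (x + ∑ i, T (S i)))
      (Measure.pi (fun _ : Fin n => P)) := fun n x =>
    Integrable.of_mem_Icc _ _ (hmeas n x).aemeasurable (hIcc n x)
  refine ⟨fun t => integrable_exp_mul_of_mem_Icc ((hmeas n x).sub_const _).aemeasurable
    (a := g x - n * C - ∫ S', g (x + ∑ i, T (S' i)) ∂Measure.pi (fun _ : Fin n => P))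
    (b := g x + n * C - ∫ S', g (x + ∑ i, T (S' i)) ∂Measure.pi (fun _ : Fin n => P)) ?_,
    fun t => ?_⟩
  · filter_upwards [hIcc n x] with S hS
    exact ⟨sub_le_sub_right hS.1 _, sub_le_sub_right hS.2 _⟩
  -- The uncentred form suits induction: the mean depends on the base point `x`, which moves to `x +
  -- T z` when a sample is split off.
  suffices H : ∫ S : Fin n → Z, Real.exp (t * g (x + ∑ i, T (S i)))
        ∂Measure.pi (fun _ : Fin n => P) ≤ Real.exp (t * (∫ S : Fin n → Z, g (x + ∑ i, T (S i)) ∂Measure.pi (fun _ : Fin n => P))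
        + n * (C ^ 2 * t ^ 2 / 2)) by
    simp only [mgf, mul_sub, Real.exp_sub, integral_div]
    refine (div_le_div_of_nonneg_right H (Real.exp_nonneg _)).trans_eq ?_
    rw [← Real.exp_sub]
    congr 1
    push_cast
    ring
  induction n generalizing x with
  | zero => simp
  | succ n ih =>
    have hmp := (measurePreserving_piFinSuccAbove (fun _ : Fin (n + 1) => P) 0).symm
    have hsplit : ∀ F : E → ℝ, ∫ S : Fin (n + 1) → Z, F (x + ∑ i, T (S i))
          ∂Measure.pi (fun _ : Fin (n + 1) => P) =
        ∫ w : Z × (Fin n → Z), F (x + T w.1 + ∑ i, T (w.2 i))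
          ∂(P.prod (Measure.pi fun _ : Fin n => P)) := by
      intro F
      rw [← hmp.integral_comp']
      simp [MeasurableEquiv.piFinSuccAbove_symm_apply, Fin.insertNthEquiv, Fin.sum_univ_succ,
        add_assoc]
    have hIcc' : ∀ᵐ w ∂(P.prod (Measure.pi fun _ : Fin n => P)),
        g (x + T w.1 + ∑ i, T (w.2 i)) ∈
          Set.Icc (g x - (n + 1 : ℕ) * C) (g x + (n + 1 : ℕ) * C) := by
      have := hmp.quasiMeasurePreserving.ae (hIcc (n + 1) x)
      filter_upwards [this] with w hw
      simpa [MeasurableEquiv.piFinSuccAbove_symm_apply, Fin.insertNthEquiv, Fin.sum_univ_succ,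
        add_assoc] using hw
    have hm' : Measurable fun w : Z × (Fin n → Z) => g (x + T w.1 + ∑ i, T (w.2 i)) := by fun_prop
    -- `h (x + T z)` is the conditional mean given that the first sample is `z`. Averaging over the
    -- other samples preserves the increment bound `C`.
    set h : E → ℝ := fun x =>
      ∫ S : Fin n → Z, g (x + ∑ i, T (S i)) ∂Measure.pi (fun _ : Fin n => P)
    have hhm : Measurable h := by
      have : Measurable fun w : E × (Fin n → Z) => g (w.1 + ∑ i, T (w.2 i)) := by fun_prop
      exact this.stronglyMeasurable.integral_prod_right'.measurable
    have hhC : ∀ᵐ z ∂P, h (x + T z) ∈ Set.Icc (h x - C) (h x + C) := by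
      filter_upwards [hC] with z hz
      have : |h (x + T z) - h x| ≤ C := by
        rw [← integral_sub (hint n _) (hint n _)]
        have hb := norm_integral_le_of_norm_le_const (μ := Measure.pi (fun _ : Fin n => P))
          (f := fun S => g (x + T z + ∑ i, T (S i)) - g (x + ∑ i, T (S i))) (C := (C : ℝ))
        rw [probReal_univ, mul_one] at hb
        refine hb (ae_of_all _ fun S => ?_)
        rw [Real.norm_eq_abs, add_right_comm]
        exact hz (x + ∑ i, T (S i))
      have := abs_le.1 this
      constructor <;> linarith
    have hhm' : Measurable fun z => h (x + T z) := by fun_prop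
    rw [hsplit (fun u => Real.exp (t * g u)), hsplit g,
      integral_prod _ (integrable_exp_mul_of_mem_Icc hm'.aemeasurable hIcc'),
      integral_prod _ (Integrable.of_mem_Icc _ _ hm'.aemeasurable hIcc')]
    -- Hoeffding's lemma on an interval of length `2C` gives the variance proxy `C²`.
    have hoeff := (hasSubgaussianMGF_of_mem_Icc hhm'.aemeasurable hhC).mgf_le t
    have hc : ((((‖(h x + C) - (h x - C)‖₊ / 2) ^ 2 : ℝ≥0)) : ℝ) = C ^ 2 := by
      have : h x + C - (h x - C) = 2 * (C : ℝ) := by ring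
      rw [this]
      simp
    rw [hc] at hoeff
    simp only [mgf, mul_sub, Real.exp_sub, integral_div] at hoeff
    calc ∫ z, ∫ S : Fin n → Z, Real.exp (t * g (x + T z + ∑ i, T (S i)))
            ∂Measure.pi (fun _ : Fin n => P) ∂P
        ≤ ∫ z, Real.exp (t * h (x + T z)) * Real.exp (n * (C ^ 2 * t ^ 2 / 2)) ∂P := by
          refine integral_mono_of_nonneg (ae_of_all _ fun z => integral_nonneg fun S =>
            Real.exp_nonneg _) ((integrable_exp_mul_of_mem_Icc hhm'.aemeasurable hhC).mul_const _)
            (ae_of_all _ fun z => ?_)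
          simp only [← Real.exp_add]
          exact ih (x + T z)
      _ = (∫ z, Real.exp (t * h (x + T z)) ∂P) * Real.exp (n * (C ^ 2 * t ^ 2 / 2)) :=
          integral_mul_const _ _
      _ ≤ (Real.exp (C ^ 2 * t ^ 2 / 2) * Real.exp (t * ∫ z, h (x + T z) ∂P)) *
            Real.exp (n * (C ^ 2 * t ^ 2 / 2)) := by
          refine mul_le_mul_of_nonneg_right ?_ (Real.exp_nonneg _)
          exact (div_le_iff₀ (Real.exp_pos _)).1 hoeff
      _ = _ := by
          rw [← Real.exp_add, ← Real.exp_add]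
          congr 1
          push_cast
          ring

end Concentration

/-! ### Mean deviation of an empirical average. -/

section MeanDeviation

variable {Z ι : Type*} [MeasurableSpace Z] {P : Measure Z} [IsProbabilityMeasure P] [Fintype ι]

/-- The expected distance between the empirical mean and the mean of a bounded random vector. -/
theorem integral_norm_integral_sub_smul_sum_le {U : Z → EuclideanSpace ℝ ι} (hU : Measurable U)
    {D : ℝ} (hD : ∀ᵐ z ∂P, ‖U z‖ ≤ D) {n : ℕ} (hn : 0 < n) :
    ∫ S, ‖(∫ z, U z ∂P) - (n : ℝ)⁻¹ • ∑ i, U (S i)‖ ∂Measure.pi (fun _ : Fin n => P) ≤ D / √n := by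
  have hD0 : 0 ≤ D := by
    obtain ⟨z, hz⟩ := hD.exists
    exact (norm_nonneg _).trans hz
  have hn' : (0 : ℝ) < n := by exact_mod_cast hn
  have hUm : MemLp U 2 P := MemLp.of_bound hU.aestronglyMeasurable D hD
  have hUi : Integrable U P := hUm.integrable (by norm_num)
  have hUk : ∀ k, MemLp (fun z => U z k) 2 P := fun k =>
    MemLp.of_bound (by fun_prop) D (hD.mono fun z hz => (PiLp.norm_apply_le _ k).trans hz)
  set μ := Measure.pi (fun _ : Fin n => P)
  set Y : (Fin n → Z) → EuclideanSpace ℝ ι :=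
    fun S => (∫ z, U z ∂P) - (n : ℝ)⁻¹ • ∑ i, U (S i) with hY
  have hYm : MemLp Y 2 μ := by
    have := memLp_finsetSum (μ := μ) (p := 2) Finset.univ
      (f := fun (i : Fin n) (S : Fin n → Z) => U (S i))
      fun i _ => hUm.comp_measurePreserving (measurePreserving_eval _ i)
    exact (memLp_const _).sub (this.const_smul (n : ℝ)⁻¹)
  have hcoord : ∀ k S, Y S k = (∫ z, U z k ∂P) - (n : ℝ)⁻¹ * ∑ i, U (S i) k := by
    intro k S
    have : (∫ z, U z ∂P) k = ∫ z, U z k ∂P :=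
      ((EuclideanSpace.proj k : EuclideanSpace ℝ ι →L[ℝ] ℝ).integral_comp_comm hUi).symm
    simp [hY, this]
  -- By independence, the variances of the `n` summands add up in each coordinate.
  have hvar : ∀ k, ∫ S, (Y S k) ^ 2 ∂μ ≤ (n : ℝ)⁻¹ * ∫ z, (U z k) ^ 2 ∂P := by
    intro k
    have h1 := variance_sum_pi (ι := Fin n) (μ := fun _ => P) (X := fun _ z => U z k) fun _ => hUk k
    have hm : Integrable (fun z => U z k) P := (hUk k).integrable (by norm_num)
    have h2 : ∫ S, (∑ i : Fin n, fun S : Fin n → Z => U (S i) k) S ∂μ = n * ∫ z, U z k ∂P := by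
      simp only [Finset.sum_apply]
      rw [integral_finsetSum]
      · simp only [μ]
        have : ∀ i : Fin n, ∫ S : Fin n → Z, U (S i) k ∂Measure.pi (fun _ : Fin n => P)
            = ∫ z, U z k ∂P := fun i =>
          integral_comp_eval (μ := fun _ : Fin n => P) (f := fun z => U z k) (by fun_prop)
        simp [this]
      · intro i _
        exact (measurePreserving_eval (fun _ : Fin n => P) i).integrable_comp_of_integrable hm
    rw [variance_eq_integral (by fun_prop), h2] at h1
    have h3 : Var[fun z => U z k; P] ≤ ∫ z, (U z k) ^ 2 ∂P := by
      simpa using variance_le_expectation_sq (μ := P) (X := fun z => U z k) (by fun_prop)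
    calc ∫ S, (Y S k) ^ 2 ∂μ
        = ∫ S, (n : ℝ)⁻¹ ^ 2 * ((∑ i : Fin n, fun S : Fin n → Z => U (S i) k) S -
            n * ∫ z, U z k ∂P) ^ 2 ∂μ := by
          congr 1 with S
          rw [hcoord, Finset.sum_apply]
          field_simp
          ring
      _ = (n : ℝ)⁻¹ ^ 2 * (n * Var[fun z => U z k; P]) := by
          rw [integral_const_mul, h1]
          simp
      _ = (n : ℝ)⁻¹ * Var[fun z => U z k; P] := by field_simp
      _ ≤ _ := by gcongr
  have hsq : ∫ S, ‖Y S‖ ^ 2 ∂μ ≤ D ^ 2 / n := by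
    have hYk : ∀ k, Integrable (fun S => (Y S k) ^ 2) μ := fun k =>
      (hYm.norm.mono' (f := fun S => Y S k) (by fun_prop)
        (ae_of_all _ fun S => PiLp.norm_apply_le _ k)).integrable_sq
    simp only [EuclideanSpace.norm_sq_eq, Real.norm_eq_abs, sq_abs]
    rw [integral_finsetSum _ fun k _ => hYk k]
    calc ∑ k, ∫ S, (Y S k) ^ 2 ∂μ ≤ ∑ k, (n : ℝ)⁻¹ * ∫ z, (U z k) ^ 2 ∂P :=
          Finset.sum_le_sum fun k _ => hvar k
      _ = (n : ℝ)⁻¹ * ∫ z, ‖U z‖ ^ 2 ∂P := by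
          simp only [EuclideanSpace.norm_sq_eq, Real.norm_eq_abs, sq_abs]
          rw [integral_finsetSum _ fun k _ => (hUk k).integrable_sq, Finset.mul_sum]
      _ ≤ (n : ℝ)⁻¹ * D ^ 2 := by
          gcongr
          calc ∫ z, ‖U z‖ ^ 2 ∂P ≤ ∫ _, D ^ 2 ∂P := by
                refine integral_mono_of_nonneg (ae_of_all _ fun z => by positivity)
                  (integrable_const _) ?_
                filter_upwards [hD] with z hz
                gcongr
            _ = D ^ 2 := by simp
      _ = D ^ 2 / n := by ring
  -- Jensen's inequality, in the form that the variance of `‖Y‖` is nonnegative.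
  have hvn : (∫ S, ‖Y S‖ ∂μ) ^ 2 ≤ ∫ S, ‖Y S‖ ^ 2 ∂μ := by
    have := variance_eq_sub (μ := μ) hYm.norm
    have h0 := variance_nonneg (fun S => ‖Y S‖) μ
    simp only [Pi.pow_apply] at this
    linarith
  have : (∫ S, ‖Y S‖ ∂μ) ^ 2 ≤ (D / √n) ^ 2 := by
    rw [div_pow, Real.sq_sqrt hn'.le]
    exact hvn.trans hsq
  exact le_of_sq_le_sq this (by positivity)

end MeanDeviation

/-! ### Outer products and linearization of the square loss. -/

section Outer

variable {ι κ : Type*}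

/-- The outer product of two vectors. -/
noncomputable def outer (u : EuclideanSpace ℝ ι) (v : EuclideanSpace ℝ κ) :
    EuclideanSpace ℝ (ι × κ) :=
  WithLp.toLp 2 fun ij => u ij.1 * v ij.2

@[simp]
theorem outer_apply (u : EuclideanSpace ℝ ι) (v : EuclideanSpace ℝ κ) (ij : ι × κ) :
    outer u v ij = u ij.1 * v ij.2 := rfl

theorem norm_outer [Fintype ι] [Fintype κ] (u : EuclideanSpace ℝ ι) (v : EuclideanSpace ℝ κ) :
    ‖outer u v‖ = ‖u‖ * ‖v‖ := by
  rw [← sq_eq_sq₀ (norm_nonneg _) (by positivity), mul_pow]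
  simp only [EuclideanSpace.norm_sq_eq, outer_apply, norm_mul, mul_pow, Fintype.sum_prod_type,
    Finset.sum_mul_sum]

theorem measurable_outer {Z : Type*} [MeasurableSpace Z] {u : Z → EuclideanSpace ℝ ι}
    {v : Z → EuclideanSpace ℝ κ} (hu : Measurable u) (hv : Measurable v) :
    Measurable fun z => outer (u z) (v z) := by
  refine (WithLp.measurable_toLp 2 _).comp (measurable_pi_lambda _ fun ij => ?_)
  fun_prop

/-- The vector `∑ a, u a • W (a, ·)`, the matrix with entries `W` applied to `u`. -/
noncomputable def contract [Fintype ι] (W : EuclideanSpace ℝ (ι × κ)) (u : EuclideanSpace ℝ ι) :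
    EuclideanSpace ℝ κ :=
  WithLp.toLp 2 fun j => ∑ a, u a * W (a, j)

@[simp]
theorem contract_apply [Fintype ι] (W : EuclideanSpace ℝ (ι × κ)) (u : EuclideanSpace ℝ ι) (j : κ) :
    contract W u j = ∑ a, u a * W (a, j) := rfl

theorem contract_add [Fintype ι] (W₁ W₂ : EuclideanSpace ℝ (ι × κ)) (u : EuclideanSpace ℝ ι) :
    contract (W₁ + W₂) u = contract W₁ u + contract W₂ u := by
  ext j
  simp [mul_add, Finset.sum_add_distrib]

theorem contract_smul [Fintype ι] (c : ℝ) (W : EuclideanSpace ℝ (ι × κ)) (u : EuclideanSpace ℝ ι) :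
    contract (c • W) u = c • contract W u := by
  ext j
  simp [Finset.mul_sum, mul_left_comm]

theorem continuous_contract [Fintype ι] (u : EuclideanSpace ℝ ι) :
    Continuous fun W : EuclideanSpace ℝ (ι × κ) => contract W u := by
  refine (PiLp.continuous_toLp 2 _).comp (continuous_pi fun j => ?_)
  fun_prop

theorem contract_outer [Fintype ι] (v u : EuclideanSpace ℝ ι) (e : EuclideanSpace ℝ κ) :
    contract (outer v e) u = inner ℝ v u • e := by
  ext j
  simp [PiLp.inner_apply, Finset.sum_mul, mul_assoc]

theorem inner_contract [Fintype ι] [Fintype κ] (W : EuclideanSpace ℝ (ι × κ))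
    (u : EuclideanSpace ℝ ι) (y : EuclideanSpace ℝ κ) :
    inner ℝ (contract W u) y = inner ℝ W (outer u y) := by
  simp only [PiLp.inner_apply, Fintype.sum_prod_type, outer_apply, contract_apply,
    RCLike.inner_apply, conj_trivial, Finset.mul_sum]
  rw [Finset.sum_comm]
  exact Finset.sum_congr rfl fun _ _ => Finset.sum_congr rfl fun _ _ => by ring

/-- The Gram vector of a family of coefficients: `∑ j, W (a, j) W (b, j)`. -/
noncomputable def gramVec [Fintype κ] (W : EuclideanSpace ℝ (ι × κ)) : EuclideanSpace ℝ (ι × ι) :=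
  WithLp.toLp 2 fun ab => ∑ j, W (ab.1, j) * W (ab.2, j)

/-- The Gram vector is the sum of `w_j ⊗ w_j` over the columns `w_j` of `W`, and `‖w_j ⊗ w_j‖ =
‖w_j‖²`. -/
theorem norm_gramVec_le [Fintype ι] [Fintype κ] (W : EuclideanSpace ℝ (ι × κ)) :
    ‖gramVec W‖ ≤ ‖W‖ ^ 2 := by
  set w : κ → EuclideanSpace ℝ ι := fun j => WithLp.toLp 2 fun a => W (a, j)
  have h : gramVec W = ∑ j, outer (w j) (w j) := by
    ext ab
    simp [gramVec, w]
  rw [h]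
  refine (norm_sum_le _ _).trans_eq ?_
  simp only [norm_outer, ← sq, EuclideanSpace.norm_sq_eq, Fintype.sum_prod_type, w]
  exact Finset.sum_comm

/-- Separates the predictor from the data: the quadratic term becomes a pairing with `u ⊗ u`. -/
theorem norm_contract_sq [Fintype ι] [Fintype κ] (W : EuclideanSpace ℝ (ι × κ))
    (u : EuclideanSpace ℝ ι) :
    ‖contract W u‖ ^ 2 = inner ℝ (gramVec W) (outer u u) := by
  rw [← real_inner_self_eq_norm_sq]
  simp only [PiLp.inner_apply, Fintype.sum_prod_type, outer_apply, contract_apply, gramVec,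
    RCLike.inner_apply, conj_trivial, Finset.mul_sum, Finset.sum_mul]
  rw [Finset.sum_comm]
  refine Finset.sum_congr rfl fun a _ => ?_
  rw [Finset.sum_comm]
  exact Finset.sum_congr rfl fun _ _ => Finset.sum_congr rfl fun _ _ => by ring

/-- The square loss of a linear predictor is affine in `(φ ⊗ φ, φ ⊗ y, ‖y‖²)`. -/
theorem norm_contract_sub_sq [Fintype ι] [Fintype κ] (W : EuclideanSpace ℝ (ι × κ))
    (u : EuclideanSpace ℝ ι) (y : EuclideanSpace ℝ κ) :
    ‖contract W u - y‖ ^ 2 =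
      inner ℝ (gramVec W) (outer u u) - 2 * inner ℝ W (outer u y) + ‖y‖ ^ 2 := by
  rw [norm_sub_sq_real, norm_contract_sq, inner_contract]

end Outer

/-! ### Extremal rank-one directions. -/

section Alignment

variable {V F : Type*} [NormedAddCommGroup V] [InnerProductSpace ℝ V] [Nontrivial V]

theorem exists_norm_eq_one_eq_smul (v : V) : ∃ e : V, ‖e‖ = 1 ∧ v = ‖v‖ • e := by
  by_cases hv : v = 0
  · obtain ⟨e, he⟩ := exists_norm_eq (E := V) zero_le_one
    exact ⟨e, he, by simp [hv]⟩
  · exact ⟨‖v‖⁻¹ • v, norm_smul_inv_norm hv, by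
      rw [smul_smul, mul_inv_cancel₀ (norm_ne_zero_iff.2 hv), one_smul]⟩

/-- If all rank-one maps of norm `β` send `u` within distance `M` of `y`, then
`β ‖u‖ + ‖y‖ ≤ M`. -/
theorem mul_norm_add_norm_le [NormedAddCommGroup F] [InnerProductSpace ℝ F] [Nontrivial F]
    {β M : ℝ} (hβ : 0 ≤ β) {u : V} {y : F}
    (h : ∀ v e, ‖v‖ = 1 → ‖e‖ = 1 → ‖(β * inner ℝ v u) • e - y‖ ≤ M) : β * ‖u‖ + ‖y‖ ≤ M := by
  obtain ⟨v, hv, huv⟩ := exists_norm_eq_one_eq_smul u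
  obtain ⟨e, he, hye⟩ := exists_norm_eq_one_eq_smul y
  have hi : inner ℝ v u = ‖u‖ := by
    rw [huv, inner_smul_right, real_inner_self_eq_norm_sq, norm_smul, hv]
    simp
  -- Predicting opposite to `y` makes the residual `-(β‖u‖ + ‖y‖) e`, the worst case.
  have h1 := h v (-e) hv (by rwa [norm_neg])
  have h2 : (β * ‖u‖) • (-e) - y = -((β * ‖u‖ + ‖y‖) • e) := by
    rw [add_smul, ← hye, smul_neg]
    abel
  rwa [hi, h2, norm_neg, norm_smul, he, mul_one, Real.norm_of_nonneg (by positivity)] at h1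

end Alignment

/-! ### Structure of the reproducing kernel Hilbert space and of the hypothesis class. -/

section HypothesisClass

theorem adjoint_featureMap (φ : X → EuclideanSpace ℝ (Fin m))
    (Q : Matrix (Fin m × Fin p) (Fin r) ℝ) (x : X) (u : rkhs φ Q) :
    ContinuousLinearMap.adjoint (featureMap φ Q x) u = u x :=
  RKHS.adjoint_kerFun x u

theorem kernel_rkhs (φ : X → EuclideanSpace ℝ (Fin m))
    (Q : Matrix (Fin m × Fin p) (Fin r) ℝ) :
    RKHS.kernel (rkhs φ Q) = entangledKernel φ Q :=
  RKHS.OfKernel.kernel_ofKernel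

theorem toEuclideanLin_mulVec_featureBlock (φ : X → EuclideanSpace ℝ (Fin m))
    (W : EuclideanSpace ℝ (Fin m × Fin p)) (x : X) :
    Matrix.toEuclideanLin (featureBlock φ p x)ᵀ W = contract W (φ x) := by
  ext j
  simp [Matrix.toEuclideanLin, Matrix.mulVec, dotProduct, featureBlock, Fintype.sum_prod_type,
    Matrix.one_apply]

/-- Cauchy–Schwarz in each row of `Q`. -/
theorem norm_toEuclideanLin_le (Q : Matrix (Fin m × Fin p) (Fin r) ℝ)
    (v : EuclideanSpace ℝ (Fin r)) :
    ‖Matrix.toEuclideanLin Q v‖ ≤ frobeniusNorm Q * ‖v‖ := by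
  rw [frobeniusNorm, EuclideanSpace.norm_eq, EuclideanSpace.norm_eq,
    ← Real.sqrt_mul (by positivity)]
  refine Real.sqrt_le_sqrt ?_
  rw [Finset.sum_mul]
  refine Finset.sum_le_sum fun i _ => ?_
  simp only [Real.norm_eq_abs, sq_abs]
  exact Finset.sum_mul_sq_le_sq_mul_sq Finset.univ (fun j => Q i j) fun j => v j

theorem entangledKernel_apply (φ : X → EuclideanSpace ℝ (Fin m))
    (Q : Matrix (Fin m × Fin p) (Fin r) ℝ) (x z : X) (y : EuclideanSpace ℝ (Fin p)) :
    entangledKernel φ Q x z y =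
      contract (Matrix.toEuclideanLin Q (Matrix.toEuclideanLin (Qᵀ * featureBlock φ p z) y))
        (φ x) := by
  rw [← toEuclideanLin_mulVec_featureBlock]
  refine WithLp.ofLp_injective 2 ?_
  simp [entangledKernel, kernelMatrix, Matrix.toEuclideanLin, Matrix.mulVec_mulVec,
    Matrix.mul_assoc]

theorem inner_contract_toEuclideanLin (φ : X → EuclideanSpace ℝ (Fin m))
    (Q : Matrix (Fin m × Fin p) (Fin r) ℝ) (x : X) (y : EuclideanSpace ℝ (Fin p))
    (w : EuclideanSpace ℝ (Fin r)) :
    inner ℝ y (contract (Matrix.toEuclideanLin Q w) (φ x)) =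
      inner ℝ (Matrix.toEuclideanLin (Qᵀ * featureBlock φ p x) y) w := by
  rw [← toEuclideanLin_mulVec_featureBlock, real_inner_comm]
  simp only [EuclideanSpace.inner_eq_star_dotProduct, Matrix.ofLp_toLpLin, Matrix.toEuclideanLin,
    Matrix.toLin'_apply, star_trivial]
  rw [Matrix.mulVec_mulVec, ← Matrix.transpose_transpose Q, ← Matrix.transpose_mul,
    Matrix.transpose_transpose, Matrix.mulVec_transpose, dotProduct_comm,
    ← Matrix.dotProduct_mulVec]

/-- Every element of the reproducing kernel Hilbert space of `K_Q` is `x ↦ (φ(x)ᵀ ⊗ I_p) Q v` with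
a coefficient vector `v` that is no longer than the element. -/
theorem exists_eq_contract (φ : X → EuclideanSpace ℝ (Fin m))
    (Q : Matrix (Fin m × Fin p) (Fin r) ℝ) (u : rkhs φ Q) :
    ∃ v : EuclideanSpace ℝ (Fin r), ‖v‖ ≤ ‖u‖ ∧
      ∀ x, u x = contract (Matrix.toEuclideanLin Q v) (φ x) := by
  have hu : u ∈ closure (Submodule.span ℝ
      {RKHS.kerFun (rkhs φ Q) x y | (x) (y)} : Set (rkhs φ Q)) := by
    rw [← Submodule.topologicalClosure_coe, RKHS.kerFun_dense]
    trivial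
  -- Norms are not additive, so the induction carries the inner product against every represented
  -- pair `(w, u')`, which is linear in `u`.
  have hspan : ∀ u ∈ Submodule.span ℝ {RKHS.kerFun (rkhs φ Q) x y | (x) (y)},
      ∃ v : EuclideanSpace ℝ (Fin r), (∀ x, u x = contract (Matrix.toEuclideanLin Q v) (φ x)) ∧
        ∀ (w : EuclideanSpace ℝ (Fin r)) (u' : rkhs φ Q),
          (∀ x, u' x = contract (Matrix.toEuclideanLin Q w) (φ x)) →
            inner ℝ u u' = inner ℝ v w := by
    intro u hu
    induction hu using Submodule.span_induction with
    | mem u hu =>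
      obtain ⟨z, y, rfl⟩ := hu
      refine ⟨Matrix.toEuclideanLin (Qᵀ * featureBlock φ p z) y, fun x => ?_, fun w u' hu' => ?_⟩
      · rw [RKHS.kerFun_apply, kernel_rkhs, entangledKernel_apply]
      · rw [RKHS.kerFun_inner, hu', inner_contract_toEuclideanLin]
    | zero => exact ⟨0, fun x => by ext j; simp, fun w u' _ => by simp⟩
    | add u₁ u₂ _ _ h₁ h₂ =>
      obtain ⟨v₁, hv₁, hw₁⟩ := h₁
      obtain ⟨v₂, hv₂, hw₂⟩ := h₂
      refine ⟨v₁ + v₂, fun x => ?_, fun w u' hu' => ?_⟩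
      · rw [RKHS.coe_add, Pi.add_apply, hv₁, hv₂, map_add, contract_add]
      · rw [inner_add_left, inner_add_left, hw₁ w u' hu', hw₂ w u' hu']
    | smul c u₁ _ h₁ =>
      obtain ⟨v₁, hv₁, hw₁⟩ := h₁
      refine ⟨c • v₁, fun x => ?_, fun w u' hu' => ?_⟩
      · rw [RKHS.coe_smul, Pi.smul_apply, hv₁, map_smul, contract_smul]
      · rw [real_inner_smul_left, real_inner_smul_left, hw₁ w u' hu']
  obtain ⟨s, hs, hsu⟩ := mem_closure_iff_seq_limit.1 hu
  choose v hv hw using fun k => hspan (s k) (hs k)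
  have hnorm : ∀ k, ‖v k‖ = ‖s k‖ := fun k => by
    -- Pairing `s k` with itself yields `‖v k‖ = ‖s k‖`.
    have := hw k (v k) (s k) (hv k)
    rw [real_inner_self_eq_norm_sq, real_inner_self_eq_norm_sq] at this
    exact ((sq_eq_sq₀ (norm_nonneg _) (norm_nonneg _)).1 this).symm
  have hbdd : Bornology.IsBounded (Set.range v) := by
    obtain ⟨R, hR⟩ := (Metric.isBounded_range_of_tendsto s hsu).exists_norm_le
    refine isBounded_iff_forall_norm_le.2 ⟨R, ?_⟩
    rintro _ ⟨k, rfl⟩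
    rw [hnorm]
    exact hR _ ⟨k, rfl⟩
  -- The coefficients need not converge, but bounded sequences in `ℝ^r` have convergent
  -- subsequences, and point evaluations are continuous.
  obtain ⟨w, -, ψ, hψ, hlim⟩ := tendsto_subseq_of_bounded hbdd fun k => Set.mem_range_self k
  have hsψ := hsu.comp hψ.tendsto_atTop
  refine ⟨w, le_of_tendsto_of_tendsto' hlim.norm hsψ.norm fun k => (hnorm (ψ k)).le, fun x => ?_⟩
  have hcont : Continuous fun v : EuclideanSpace ℝ (Fin r) =>
      contract (Matrix.toEuclideanLin Q v) (φ x) := by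
    have h1 : Continuous (Matrix.toEuclideanLin Q) := LinearMap.continuous_of_finiteDimensional _
    exact (continuous_contract (φ x)).comp h1
  refine tendsto_nhds_unique (((RKHS.continuous_eval x).tendsto u).comp hsψ) ?_
  refine ((hcont.tendsto w).comp hlim).congr fun k => ?_
  exact (hv (ψ k) x).symm

/-- Rank-one maps of norm `β` belong to the hypothesis class. -/
theorem rankOne_mem_hypothesisClass [NeZero r] (φ : X → EuclideanSpace ℝ (Fin m)) {β : ℝ}
    (hβ : 0 ≤ β) {v : EuclideanSpace ℝ (Fin m)} {e : EuclideanSpace ℝ (Fin p)} (hv : ‖v‖ = 1)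
    (he : ‖e‖ = 1) : (fun x => (β * inner ℝ v (φ x)) • e) ∈ hypothesisClass φ p r β := by
  -- With `v ⊗ e` as the only nonzero column, the kernel is `⟨v, φ(x)⟩⟨v, φ(z)⟩ e eᵀ`.
  set Q : Matrix (Fin m × Fin p) (Fin r) ℝ :=
    Matrix.of fun ij k => if k = 0 then outer v e ij else 0 with hQ
  have hQn : frobeniusNorm Q = 1 := by
    have : ‖outer v e‖ = 1 := by rw [norm_outer, hv, he, one_mul]
    rw [EuclideanSpace.norm_eq] at this
    rw [← this, frobeniusNorm]
    simp [hQ, ite_pow, mul_pow]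
  have hK : ∀ x z y, entangledKernel φ Q x z y =
      (inner ℝ v (φ x) * inner ℝ v (φ z) * inner ℝ e y) • e := by
    intro x z y
    have hQw : ∀ w, Matrix.toEuclideanLin Q w = w 0 • outer v e := by
      intro w
      ext i
      simp [Matrix.toEuclideanLin, Matrix.mulVec, dotProduct, hQ, mul_comm]
    have h0 : ∀ w : EuclideanSpace ℝ (Fin r),
        w 0 = inner ℝ w (EuclideanSpace.single 0 (1 : ℝ)) := by
      simp [EuclideanSpace.inner_single_right]
    rw [entangledKernel_apply, hQw, contract_smul, contract_outer, smul_smul, h0,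
      ← inner_contract_toEuclideanLin, hQw, contract_smul, contract_outer, smul_smul,
      real_inner_smul_right, real_inner_comm e y, PiLp.single_apply, if_pos rfl]
    congr 1
    ring
  by_cases h0 : ∃ x₀, inner ℝ v (φ x₀) ≠ 0
  · obtain ⟨x₀, hx₀⟩ := h0
    -- The section `K_Q(·, x₀) e` has norm `|⟨v, φ(x₀)⟩|`, so this multiple has norm `β`.
    refine ⟨Q, hQn, (β / inner ℝ v (φ x₀)) • RKHS.kerFun (rkhs φ Q) x₀ e, ?_, ?_⟩
    · have h1 : ‖RKHS.kerFun (rkhs φ Q) x₀ e‖ = |inner ℝ v (φ x₀)| := by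
        rw [← sq_eq_sq₀ (norm_nonneg _) (abs_nonneg _), ← real_inner_self_eq_norm_sq,
          ← RKHS.kernel_inner, kernel_rkhs, hK, real_inner_smul_left,
          real_inner_self_eq_norm_sq, he, sq_abs]
        ring
      rw [norm_smul, h1, norm_div, Real.norm_eq_abs, Real.norm_eq_abs,
        div_mul_cancel₀ _ (abs_ne_zero.2 hx₀), abs_of_nonneg hβ]
    · funext x
      rw [adjoint_featureMap, RKHS.coe_smul, Pi.smul_apply, RKHS.kerFun_apply, kernel_rkhs, hK,
        smul_smul, real_inner_self_eq_norm_sq, he]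
      congr 1
      field_simp
  · push Not at h0
    refine ⟨Q, hQn, 0, by simpa using hβ, ?_⟩
    funext x
    simp [h0]

end HypothesisClass

/-! ### Sufficient statistics and the uniform gap. -/

section Generalization

/-- Take `W = Q v`. The pair `(Q, u)` then enters only through `‖W‖ ≤ β`, with no dependence on `r`.
-/
theorem exists_eq_contract_of_mem_hypothesisClass {φ : X → EuclideanSpace ℝ (Fin m)} {β : ℝ}
    {f : X → EuclideanSpace ℝ (Fin p)} (hf : f ∈ hypothesisClass φ p r β) :
    ∃ W : EuclideanSpace ℝ (Fin m × Fin p), ‖W‖ ≤ β ∧ ∀ x, f x = contract W (φ x) := by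
  obtain ⟨Q, hQ, u, hu, rfl⟩ := hf
  obtain ⟨v, hv, hvu⟩ := exists_eq_contract φ Q u
  refine ⟨Matrix.toEuclideanLin Q v, ?_, fun x => ?_⟩
  · have := norm_toEuclideanLin_le Q v
    rw [hQ, one_mul] at this
    exact this.trans (hv.trans hu)
  · exact (adjoint_featureMap φ Q x u).trans (hvu x)

theorem pos_of_frobeniusNorm_eq_one {Q : Matrix (Fin m × Fin p) (Fin r) ℝ}
    (hQ : frobeniusNorm Q = 1) : 0 < m ∧ 0 < p ∧ 0 < r := by
  refine ⟨?_, ?_, ?_⟩ <;>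
  · rw [Nat.pos_iff_ne_zero]
    rintro rfl
    simp [frobeniusNorm] at hQ

variable [MeasurableSpace X]

/-- An almost sure bound on a family of functions depending continuously on a parameter in a
separable space holds almost surely for all parameters simultaneously. -/
theorem ae_forall_le_of_continuous {A Z : Type*} [TopologicalSpace A]
    [TopologicalSpace.SeparableSpace A] [Nonempty A] [MeasurableSpace Z] {P : Measure Z}
    {F : A → Z → ℝ} {M : ℝ} (hF : ∀ z, Continuous fun a => F a z)
    (h : ∀ a, ∀ᵐ z ∂P, F a z ≤ M) : ∀ᵐ z ∂P, ∀ a, F a z ≤ M := by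
  filter_upwards [ae_all_iff.2 fun k => h (TopologicalSpace.denseSeq A k)] with z hz a
  exact (TopologicalSpace.denseRange_denseSeq A).induction_on a
    (isClosed_le (hF z) continuous_const) hz

/-- The preceding statement with a pair of unit vectors as the parameter. -/
theorem ae_forall_sphere_le_of_continuous {V E Z : Type*} [NormedAddCommGroup V] [NormedSpace ℝ V]
    [NormedAddCommGroup E] [NormedSpace ℝ E] [Nontrivial V] [Nontrivial E]
    [SecondCountableTopology V] [SecondCountableTopology E] [MeasurableSpace Z] {P : Measure Z}
    {F : V → E → Z → ℝ} {M : ℝ} (hF : ∀ z, Continuous fun a : V × E => F a.1 a.2 z)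
    (h : ∀ v e, ‖v‖ = 1 → ‖e‖ = 1 → ∀ᵐ z ∂P, F v e z ≤ M) :
    ∀ᵐ z ∂P, ∀ v e, ‖v‖ = 1 → ‖e‖ = 1 → F v e z ≤ M := by
  obtain ⟨v₀, hv₀⟩ := exists_norm_eq V zero_le_one
  obtain ⟨e₀, he₀⟩ := exists_norm_eq E zero_le_one
  have : Nonempty {a : V × E // ‖a.1‖ = 1 ∧ ‖a.2‖ = 1} := ⟨⟨(v₀, e₀), hv₀, he₀⟩⟩
  have hall := ae_forall_le_of_continuous (P := P) (M := M)
    (F := fun (a : {a : V × E // ‖a.1‖ = 1 ∧ ‖a.2‖ = 1}) z => F a.1.1 a.1.2 z)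
    (fun z => (hF z).comp continuous_subtype_val) fun a => h _ _ a.2.1 a.2.2
  filter_upwards [hall] with z hz v e hv he
  exact hz ⟨(v, e), hv, he⟩

/-- A uniform almost sure bound on the residuals of the hypothesis class bounds the features and
the labels. -/
theorem ae_mul_norm_add_norm_le [NeZero m] [NeZero p] [NeZero r]
    {φ : X → EuclideanSpace ℝ (Fin m)} {P : Measure (X × EuclideanSpace ℝ (Fin p))} {β M : ℝ}
    (hβ : 0 ≤ β) (hbound : ∀ f ∈ hypothesisClass φ p r β, ∀ᵐ z ∂P, ‖f z.1 - z.2‖ ≤ M) :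
    ∀ᵐ z ∂P, β * ‖φ z.1‖ + ‖z.2‖ ≤ M := by
  have h : ∀ v e, ‖v‖ = 1 → ‖e‖ = 1 → ∀ᵐ z ∂P, ‖(β * inner ℝ v (φ z.1)) • e - z.2‖ ≤ M := by
    intro v e hv he
    have := hbound _ (rankOne_mem_hypothesisClass φ hβ hv he)
    exact this
  have hall := ae_forall_sphere_le_of_continuous
    (F := fun (v : EuclideanSpace ℝ (Fin m)) (e : EuclideanSpace ℝ (Fin p))
      (z : X × EuclideanSpace ℝ (Fin p)) => ‖(β * inner ℝ v (φ z.1)) • e - z.2‖)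
    (fun z => by fun_prop) h
  filter_upwards [hall] with z hz
  exact mul_norm_add_norm_le hβ hz

variable {φ : X → EuclideanSpace ℝ (Fin m)} {P : Measure (X × EuclideanSpace ℝ (Fin p))}

/-- The sufficient statistics `(β φ ⊗ φ, φ ⊗ y, ‖y‖²)` of the square loss. -/
noncomputable def lossFeature (φ : X → EuclideanSpace ℝ (Fin m)) (β : ℝ)
    (z : X × EuclideanSpace ℝ (Fin p)) :
    EuclideanSpace ℝ (Fin m × Fin m) × EuclideanSpace ℝ (Fin m × Fin p) × ℝ :=
  (β • outer (φ z.1) (φ z.1), outer (φ z.1) z.2, ‖z.2‖ ^ 2)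

theorem measurable_lossFeature (hφ : Measurable φ) (β : ℝ) :
    Measurable (lossFeature (p := p) φ β) := by
  refine Measurable.prodMk ?_ (Measurable.prodMk ?_ ?_)
  · exact (measurable_outer (hφ.comp measurable_fst) (hφ.comp measurable_fst)).const_smul β
  · exact measurable_outer (hφ.comp measurable_fst) measurable_snd
  · fun_prop

/-- A weighted gap between a mean `c` and an empirical mean `u` of sufficient statistics. -/
noncomputable def gap {E F : Type*} [NormedAddCommGroup E] [NormedAddCommGroup F] (β : ℝ)
    (c u : E × F × ℝ) : ℝ :=
  β * ‖c.1 - u.1‖ + 2 * β * ‖c.2.1 - u.2.1‖ + (c.2.2 - u.2.2)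

/-- The reverse triangle inequality gives a bound independent of `u`, as the concentration lemma
requires. -/
theorem abs_gap_add_sub_gap_le {E F : Type*} [NormedAddCommGroup E] [NormedAddCommGroup F] {β : ℝ}
    (hβ : 0 ≤ β) (c u t : E × F × ℝ) :
    |gap β c (u + t) - gap β c u| ≤ β * ‖t.1‖ + 2 * β * ‖t.2.1‖ + |t.2.2| := by
  have h1 := abs_le.1 (abs_norm_sub_norm_le (c.1 - (u.1 + t.1)) (c.1 - u.1))
  have h2 := abs_le.1 (abs_norm_sub_norm_le (c.2.1 - (u.2.1 + t.2.1)) (c.2.1 - u.2.1))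
  rw [show c.1 - (u.1 + t.1) - (c.1 - u.1) = -t.1 by abel, norm_neg] at h1
  rw [show c.2.1 - (u.2.1 + t.2.1) - (c.2.1 - u.2.1) = -t.2.1 by abel, norm_neg] at h2
  have h3 := neg_abs_le t.2.2
  have h4 := le_abs_self t.2.2
  simp only [gap, Prod.fst_add, Prod.snd_add]
  rw [abs_le]
  constructor <;> nlinarith [mul_le_mul_of_nonneg_left h1.1 hβ, mul_le_mul_of_nonneg_left h1.2 hβ,
    mul_le_mul_of_nonneg_left h2.1 hβ, mul_le_mul_of_nonneg_left h2.2 hβ]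

theorem integrable_of_ae_norm_le {Z E : Type*} [MeasurableSpace Z] {P : Measure Z}
    [IsProbabilityMeasure P] [NormedAddCommGroup E] [MeasurableSpace E] [BorelSpace E]
    [SecondCountableTopology E] {U : Z → E} (hU : Measurable U) {D : ℝ}
    (hD : ∀ᵐ z ∂P, ‖U z‖ ≤ D) : Integrable U P :=
  (MemLp.of_bound (p := 1) hU.aestronglyMeasurable D hD).integrable le_rfl

/-- In each of the first two statistics one factor `‖φ‖` is at most `√κ` and the other, `β‖φ‖` or
`‖y‖`, is at most `M`. The factor `β` in the first statistic gives both the same bound. -/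
theorem ae_norm_lossFeature_le {β κ M : ℝ} (hβ : 0 ≤ β) (hκ : ∀ x, scalarKernel φ x x ≤ κ)
    (hM : ∀ᵐ z ∂P, β * ‖φ z.1‖ + ‖z.2‖ ≤ M) :
    ∀ᵐ z ∂P, ‖(lossFeature φ β z).1‖ ≤ M * √κ ∧ ‖(lossFeature φ β z).2.1‖ ≤ M * √κ ∧
      ‖(lossFeature φ β z).2.2‖ ≤ M ^ 2 := by
  filter_upwards [hM] with z hz
  have hφκ : ‖φ z.1‖ ≤ √κ := by
    refine Real.le_sqrt_of_sq_le ?_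
    rw [← real_inner_self_eq_norm_sq]
    exact hκ z.1
  have h1 : β * ‖φ z.1‖ ≤ M := by linarith [norm_nonneg z.2]
  have h2 : ‖z.2‖ ≤ M := by linarith [mul_nonneg hβ (norm_nonneg (φ z.1))]
  have hM0 : 0 ≤ M := (norm_nonneg _).trans h2
  refine ⟨?_, ?_, ?_⟩
  · rw [lossFeature, norm_smul, norm_outer, Real.norm_of_nonneg hβ, ← mul_assoc]
    exact mul_le_mul h1 hφκ (norm_nonneg _) hM0
  · rw [lossFeature, norm_outer, mul_comm]
    exact mul_le_mul h2 hφκ (norm_nonneg _) hM0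
  · rw [lossFeature, norm_pow, norm_norm]
    gcongr

theorem integrable_lossFeature [IsProbabilityMeasure P] (hφ : Measurable φ) {β κ M : ℝ}
    (hβ : 0 ≤ β) (hκ : ∀ x, scalarKernel φ x x ≤ κ) (hM : ∀ᵐ z ∂P, β * ‖φ z.1‖ + ‖z.2‖ ≤ M) :
    Integrable (lossFeature φ β) P := by
  have hb := ae_norm_lossFeature_le hβ hκ hM
  have hm := measurable_lossFeature (p := p) hφ β
  refine Integrable.prodMk ?_ (Integrable.prodMk ?_ ?_)
  · exact integrable_of_ae_norm_le hm.fst (hb.mono fun z hz => hz.1)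
  · exact integrable_of_ae_norm_le hm.snd.fst (hb.mono fun z hz => hz.2.1)
  · exact integrable_of_ae_norm_le hm.snd.snd (hb.mono fun z hz => hz.2.2)

/-- On every sample, the excess of the risk over the empirical risk is at most the gap between the
mean and the empirical mean of the sufficient statistics, uniformly over the hypothesis class. -/
theorem risk_le_empiricalRisk_add_gap [IsProbabilityMeasure P] (hφ : Measurable φ) {β κ M : ℝ}
    (hβ : 0 ≤ β) (hκ : ∀ x, scalarKernel φ x x ≤ κ)
    (hM : ∀ᵐ z ∂P, β * ‖φ z.1‖ + ‖z.2‖ ≤ M)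
    {f : X → EuclideanSpace ℝ (Fin p)} (hf : f ∈ hypothesisClass φ p r β)
    (S : Fin n → X × EuclideanSpace ℝ (Fin p)) :
    risk P f ≤ empiricalRisk S f +
      gap β (∫ z, lossFeature φ β z ∂P) (∑ i, (n : ℝ)⁻¹ • lossFeature φ β (S i)) := by
  obtain ⟨W, hW, hfW⟩ := exists_eq_contract_of_mem_hypothesisClass hf
  have hint := integrable_lossFeature hφ hβ hκ hM
  -- For `β = 0` the scaled statistic says nothing about `φ ⊗ φ`, so integrability comes from `κ`.
  have hi₁ : Integrable (fun z : X × EuclideanSpace ℝ (Fin p) => outer (φ z.1) (φ z.1)) P := by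
    refine integrable_of_ae_norm_le (D := κ)
      (measurable_outer (hφ.comp measurable_fst) (hφ.comp measurable_fst)) (ae_of_all _ fun z => ?_)
    rw [norm_outer, ← sq, ← real_inner_self_eq_norm_sq]
    exact hκ z.1
  have hi₂ : Integrable (fun z : X × EuclideanSpace ℝ (Fin p) => outer (φ z.1) z.2) P :=
    Integrable.fst (Integrable.snd hint)
  have hi₃ : Integrable (fun z : X × EuclideanSpace ℝ (Fin p) => ‖z.2‖ ^ 2) P :=
    Integrable.snd (Integrable.snd hint)
  have hc₁ : (∫ z, lossFeature φ β z ∂P).1 = β • ∫ z, outer (φ z.1) (φ z.1) ∂P := by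
    rw [fst_integral hint, ← integral_smul]
    rfl
  have hc₂ : (∫ z, lossFeature φ β z ∂P).2.1 = ∫ z, outer (φ z.1) z.2 ∂P := by
    rw [snd_integral hint, fst_integral hint.snd]
    rfl
  have hc₃ : (∫ z, lossFeature φ β z ∂P).2.2 = ∫ z, ‖z.2‖ ^ 2 ∂P := by
    rw [snd_integral hint, snd_integral hint.snd]
    rfl
  have hrisk : risk P f = inner ℝ (gramVec W) (∫ z, outer (φ z.1) (φ z.1) ∂P) -
      2 * inner ℝ W (∫ z, outer (φ z.1) z.2 ∂P) + ∫ z, ‖z.2‖ ^ 2 ∂P := by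
    simp only [risk, hfW, norm_contract_sub_sq]
    rw [integral_add (f := fun z : X × EuclideanSpace ℝ (Fin p) =>
        inner ℝ (gramVec W) (outer (φ z.1) (φ z.1)) - 2 * inner ℝ W (outer (φ z.1) z.2))
        ((hi₁.const_inner _).sub ((hi₂.const_inner _).const_mul 2)) hi₃,
      integral_sub (hi₁.const_inner _) ((hi₂.const_inner _).const_mul 2), integral_const_mul,
      integral_inner hi₁, integral_inner hi₂]
  have hemp : empiricalRisk S f =
      inner ℝ (gramVec W) (∑ i, (n : ℝ)⁻¹ • outer (φ (S i).1) (φ (S i).1)) -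
        2 * inner ℝ W (∑ i, (n : ℝ)⁻¹ • outer (φ (S i).1) (S i).2) +
          ∑ i, (n : ℝ)⁻¹ * ‖(S i).2‖ ^ 2 := by
    simp only [empiricalRisk, hfW, norm_contract_sub_sq, inner_sum, real_inner_smul_right,
      Finset.mul_sum, ← Finset.sum_sub_distrib, ← Finset.sum_add_distrib]
    exact Finset.sum_congr rfl fun i _ => by ring
  set A := ∫ z, outer (φ z.1) (φ z.1) ∂P
  set B := ∫ z, outer (φ z.1) z.2 ∂P
  set A' := ∑ i, (n : ℝ)⁻¹ • outer (φ (S i).1) (φ (S i).1) with hA'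
  set B' := ∑ i, (n : ℝ)⁻¹ • outer (φ (S i).1) (S i).2
  have hu₁ : (∑ i, (n : ℝ)⁻¹ • lossFeature φ β (S i)).1 = β • A' := by
    rw [Prod.fst_sum, hA', Finset.smul_sum]
    exact Finset.sum_congr rfl fun i _ => smul_comm _ _ _
  have hu₂ : (∑ i, (n : ℝ)⁻¹ • lossFeature φ β (S i)).2.1 = B' := by
    rw [Prod.snd_sum, Prod.fst_sum]
    rfl
  have hu₃ : (∑ i, (n : ℝ)⁻¹ • lossFeature φ β (S i)).2.2 = ∑ i, (n : ℝ)⁻¹ * ‖(S i).2‖ ^ 2 := by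
    rw [Prod.snd_sum, Prod.snd_sum]
    rfl
  -- Of the factor `β²`, one `β` belongs to the statistic and one to the weight in `gap`.
  have h₁ : inner ℝ (gramVec W) A - inner ℝ (gramVec W) A' ≤ β * (β * ‖A - A'‖) := by
    rw [← inner_sub_right, ← mul_assoc, ← sq]
    refine (real_inner_le_norm _ _).trans (mul_le_mul_of_nonneg_right ?_ (norm_nonneg _))
    exact (norm_gramVec_le W).trans (pow_le_pow_left₀ (norm_nonneg _) hW 2)
  have h₂ : inner ℝ W B' - inner ℝ W B ≤ β * ‖B - B'‖ := by
    rw [← inner_sub_right, norm_sub_rev]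
    exact (real_inner_le_norm _ _).trans (mul_le_mul_of_nonneg_right hW (norm_nonneg _))
  rw [gap, hc₁, hc₂, hc₃, hu₁, hu₂, hu₃, ← smul_sub, norm_smul, Real.norm_of_nonneg hβ, hrisk,
    hemp]
  linarith

theorem integral_mul_add_mul_add_sub {Z : Type*} [MeasurableSpace Z] {P : Measure Z}
    [IsProbabilityMeasure P] {f g h : Z → ℝ} (hf : Integrable f P) (hg : Integrable g P)
    (hh : Integrable h P) (a b c : ℝ) :
    ∫ z, a * f z + b * g z + (c - h z) ∂P =
      a * ∫ z, f z ∂P + b * ∫ z, g z ∂P + (c - ∫ z, h z ∂P) := by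
  have h₁ : Integrable (fun z => a * f z + b * g z) P := (hf.const_mul a).add (hg.const_mul b)
  have h₂ : Integrable (fun z => c - h z) P := (integrable_const c).sub hh
  rw [integral_add h₁ h₂, integral_add (hf.const_mul a) (hg.const_mul b),
    integral_sub (integrable_const c) hh, integral_const_mul, integral_const_mul, integral_const,
    probReal_univ, one_smul]

/-- The expected gap between the mean and the empirical mean. -/
theorem integral_gap_le {Z ι κ : Type*} [MeasurableSpace Z] [Fintype ι] [Fintype κ] {P : Measure Z}
    [IsProbabilityMeasure P] {L : Z → EuclideanSpace ℝ ι × EuclideanSpace ℝ κ × ℝ}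
    (hL : Measurable L) (hint : Integrable L P) {β D : ℝ} (hβ : 0 ≤ β)
    (hD₁ : ∀ᵐ z ∂P, ‖(L z).1‖ ≤ D) (hD₂ : ∀ᵐ z ∂P, ‖(L z).2.1‖ ≤ D) (hn : 0 < n) :
    ∫ S, gap β (∫ z, L z ∂P) (∑ i, (n : ℝ)⁻¹ • L (S i)) ∂Measure.pi (fun _ : Fin n => P) ≤
      3 * (β * (D / √n)) := by
  have hn' : (0 : ℝ) < n := by exact_mod_cast hn
  have h₁ := integral_norm_integral_sub_smul_sum_le hL.fst hD₁ hn
  have h₂ := integral_norm_integral_sub_smul_sum_le hL.snd.fst hD₂ hn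
  have hev : ∀ i : Fin n, Integrable (fun S : Fin n → Z => L (S i))
      (Measure.pi (fun _ : Fin n => P)) := fun i =>
    (measurePreserving_eval (fun _ : Fin n => P) i).integrable_comp_of_integrable hint
  simp only [gap, ← Finset.smul_sum, Prod.smul_fst, Prod.smul_snd, Prod.fst_sum, Prod.snd_sum,
    fst_integral hint, snd_integral hint, fst_integral hint.snd, snd_integral hint.snd]
  have hi₁ : Integrable (fun S => ‖(∫ z, (L z).1 ∂P) - (n : ℝ)⁻¹ • ∑ i, (L (S i)).1‖)
      (Measure.pi (fun _ : Fin n => P)) :=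
    ((integrable_const _).sub ((integrable_finsetSum _ fun i _ => (hev i).fst).smul (n : ℝ)⁻¹)).norm
  have hi₂ : Integrable (fun S => ‖(∫ z, (L z).2.1 ∂P) - (n : ℝ)⁻¹ • ∑ i, (L (S i)).2.1‖)
      (Measure.pi (fun _ : Fin n => P)) :=
    ((integrable_const _).sub ((integrable_finsetSum _ fun i _ => (hev i).snd.fst).smul (n : ℝ)⁻¹)).norm
  have hi₃ : Integrable (fun S => (n : ℝ)⁻¹ • ∑ i, (L (S i)).2.2)
      (Measure.pi (fun _ : Fin n => P)) :=
    (integrable_finsetSum _ fun i _ => (hev i).snd.snd).smul (n : ℝ)⁻¹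
  have h₃ : ∫ S, (n : ℝ)⁻¹ • ∑ i, (L (S i)).2.2 ∂Measure.pi (fun _ : Fin n => P) =
      ∫ z, (L z).2.2 ∂P := by
    rw [integral_smul, integral_finsetSum _ fun i _ => (hev i).snd.snd]
    have : ∀ i : Fin n, ∫ S, (L (S i)).2.2 ∂Measure.pi (fun _ : Fin n => P) =
        ∫ z, (L z).2.2 ∂P := fun i =>
      integral_comp_eval (μ := fun _ : Fin n => P) (f := fun z => (L z).2.2)
        hL.snd.snd.aestronglyMeasurable
    simp only [this, Finset.sum_const, Finset.card_univ, Fintype.card_fin, nsmul_eq_mul,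
      smul_eq_mul]
    field_simp
  -- The third term of `gap` is signed, so its mean vanishes. The weights `β` and `2β` of the two
  -- norms give the factor 3.
  rw [integral_mul_add_mul_add_sub hi₁ hi₂ hi₃, h₃, sub_self]
  have h₁' := mul_le_mul_of_nonneg_left h₁ hβ
  have h₂' := mul_le_mul_of_nonneg_left h₂ hβ
  linarith

end Generalization

end EKL

/-! ### The high-probability bound. -/

theorem mainTheorem4 {X : Type*} [MeasurableSpace X] {m p r n : ℕ} (hn : 0 < n)
    (φ : X → EuclideanSpace ℝ (Fin m)) (hφ : Measurable φ)
    (P : Measure (X × EuclideanSpace ℝ (Fin p))) [IsProbabilityMeasure P]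
    (β κ M δ : ℝ) (hκ : ∀ x, EKL.scalarKernel φ x x ≤ κ) (hM : 0 < M) (hδ : 0 < δ)
    (hbound : ∀ f ∈ EKL.hypothesisClass φ p r β, ∀ᵐ z ∂P, ‖f z.1 - z.2‖ ≤ M) :
    ENNReal.ofReal (1 - δ) ≤
      Measure.pi (fun _ : Fin n => P)
        {S | ∀ f ∈ EKL.hypothesisClass φ p r β,
          EKL.risk P f ≤ EKL.empiricalRisk S f
            + 4 * √2 * M * √(β ^ 2 * κ * p / n)
            + 3 * M ^ 2 * √(Real.log (2 / δ) / (2 * n))} := by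
  by_cases hne : (EKL.hypothesisClass φ p r β).Nonempty
  swap
  -- An empty class (for instance when `β < 0` or `m`, `p` or `r` is zero) makes the event the whole
  -- space.
  · rw [Set.not_nonempty_iff_eq_empty] at hne
    simp [hne, hδ.le]
  rcases le_or_gt 1 δ with hδ1 | hδ1
  · simp [ENNReal.ofReal_of_nonpos (sub_nonpos.2 hδ1)]
  obtain ⟨f₀, Q₀, hQ₀, u₀, hu₀, -⟩ := hne
  have hβ : 0 ≤ β := (norm_nonneg u₀).trans hu₀
  obtain ⟨hm, hp, hr⟩ := EKL.pos_of_frobeniusNorm_eq_one hQ₀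
  have : NeZero m := ⟨hm.ne'⟩
  have : NeZero p := ⟨hp.ne'⟩
  have : NeZero r := ⟨hr.ne'⟩
  have hae := EKL.ae_mul_norm_add_norm_le hβ hbound
  have hn' : (0 : ℝ) < n := by exact_mod_cast hn
  set c := ∫ z, EKL.lossFeature φ β z ∂P with hc
  set T : X × EuclideanSpace ℝ (Fin p) → _ := fun z => (n : ℝ)⁻¹ • EKL.lossFeature φ β z with hT
  have hTm : Measurable T := by
    have := EKL.measurable_lossFeature (p := p) hφ β
    simp only [hT]
    fun_prop
  have hgm : Measurable (EKL.gap β c) := by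
    unfold EKL.gap
    fun_prop
  obtain ⟨C, hCM⟩ : ∃ C : NNReal, (C : ℝ) = M ^ 2 / n := ⟨⟨M ^ 2 / n, by positivity⟩, rfl⟩
  have hC : ∀ᵐ z ∂P, ∀ x, |EKL.gap β c (x + T z) - EKL.gap β c x| ≤ C := by
    filter_upwards [hae] with z hz x
    refine (EKL.abs_gap_add_sub_gap_le hβ c x (T z)).trans ?_
    -- The three increments form a perfect square.
    have h1 : β * ‖(T z).1‖ + 2 * β * ‖(T z).2.1‖ + |(T z).2.2| =
        (β * ‖φ z.1‖ + ‖z.2‖) ^ 2 / n := by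
      simp only [hT, EKL.lossFeature, Prod.smul_mk, norm_smul, EKL.norm_outer, smul_eq_mul, abs_mul,
        Real.norm_eq_abs, abs_inv, Nat.abs_cast, abs_of_nonneg hβ, abs_pow, abs_norm]
      field_simp
      ring
    rw [h1, hCM]
    gcongr
  have hsub := EKL.hasSubgaussianMGF_comp_sum hTm hgm hC n 0
  simp only [zero_add] at hsub
  set μ := Measure.pi (fun _ : Fin n => P)
  set G : (Fin n → X × EuclideanSpace ℝ (Fin p)) → ℝ := fun S => EKL.gap β c (∑ i, T (S i)) with hG
  set t := 3 * M ^ 2 * √(Real.log (2 / δ) / (2 * n)) with ht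
  have hlog : 0 ≤ Real.log (2 / δ) := Real.log_nonneg (by rw [le_div_iff₀ hδ]; linarith)
  have htail := hsub.measure_ge_le (ε := t) (by positivity)
  have hexp : Real.exp (-t ^ 2 / (2 * ((n * C ^ 2 : NNReal) : ℝ)))
      ≤ δ := by
    -- The variance proxy is `n (M²/n)² = M⁴/n` and `t² = 9 M⁴ log(2/δ) / (2n)`.
    have h1 : -t ^ 2 / (2 * ((n * C ^ 2 : NNReal) : ℝ)) =
        -(9 / 4 * Real.log (2 / δ)) := by
      have h2 : t ^ 2 = 9 * M ^ 4 * (Real.log (2 / δ) / (2 * n)) := by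
        rw [ht, mul_pow, Real.sq_sqrt (by positivity)]
        ring
      rw [h2]
      push_cast
      rw [hCM]
      field_simp
      ring
    rw [h1]
    calc Real.exp (-(9 / 4 * Real.log (2 / δ))) ≤ Real.exp (-Real.log (2 / δ)) := by
          gcongr
          linarith
      _ = δ / 2 := by rw [Real.exp_neg, Real.exp_log (by positivity), inv_div]
      _ ≤ δ := by linarith
  have hGm : Measurable G := by
    simp only [hG]
    fun_prop
  have hbad : μ {S | t ≤ G S - ∫ S', G S' ∂μ} ≤ ENNReal.ofReal δ := by
    rw [← ENNReal.ofReal_toReal (measure_ne_top μ _)]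
    exact ENNReal.ofReal_le_ofReal (htail.trans hexp)
  have hmean : ∫ S, G S ∂μ ≤ 4 * √2 * M * √(β ^ 2 * κ * p / n) := by
    have hb := EKL.ae_norm_lossFeature_le hβ hκ hae
    have hD : β * (M * √κ / √n) = M * √(β ^ 2 * κ / n) := by
      rw [Real.sqrt_div' _ hn'.le, Real.sqrt_mul (sq_nonneg β), Real.sqrt_sq hβ]
      ring
    refine (EKL.integral_gap_le (EKL.measurable_lossFeature hφ β)
      (EKL.integrable_lossFeature hφ hβ hκ hae) hβ (hb.mono fun z hz => hz.1)
      (hb.mono fun z hz => hz.2.1) hn).trans ?_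
    rw [hD]
    have hX : Nonempty X := by
      obtain ⟨z, -⟩ := hae.exists
      exact ⟨z.1⟩
    have hκ0 : 0 ≤ κ := (real_inner_self_nonneg (F := EuclideanSpace ℝ (Fin m))).trans (hκ hX.some)
    have hp1 : (1 : ℝ) ≤ p := by exact_mod_cast hp
    have h2 : (1 : ℝ) ≤ √2 := Real.one_le_sqrt.2 (by norm_num)
    rw [← mul_assoc]
    -- The slack is `3 ≤ 4√2` and `p ≥ 1`.
    refine mul_le_mul (mul_le_mul_of_nonneg_right (by linarith) hM.le)
      (Real.sqrt_le_sqrt (div_le_div_of_nonneg_right ?_ hn'.le)) (Real.sqrt_nonneg _)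
      (by positivity)
    · exact le_mul_of_one_le_right (mul_nonneg (sq_nonneg β) hκ0) hp1
  calc ENNReal.ofReal (1 - δ) = 1 - ENNReal.ofReal δ := by
        rw [ENNReal.ofReal_sub _ hδ.le, ENNReal.ofReal_one]
    _ ≤ 1 - μ {S | t ≤ G S - ∫ S', G S' ∂μ} := tsub_le_tsub_left hbad _
    _ = μ {S | t ≤ G S - ∫ S', G S' ∂μ}ᶜ :=
        (prob_compl_eq_one_sub (measurableSet_le measurable_const (hGm.sub_const _))).symm
    _ ≤ _ := by
        -- Monotonicity needs no measurability of the target event, an intersection over a possibly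
        -- uncountable class.
        refine measure_mono (α := Fin n → X × EuclideanSpace ℝ (Fin p)) fun S hS f hf => ?_
        have h1 := EKL.risk_le_empiricalRisk_add_gap hφ hβ hκ hae hf S
        have h2 : G S - ∫ S', G S' ∂μ < t := not_le.1 hS
        change _ ≤ _ + G S at h1
        linarith
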